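/- Let $A$ and $B$ be commutative unital C*-algebras and let $\varphi\colon A\to B$ be an injective unital $*$-homomorphism. Suppose that $B$ has real rank zero, that is, the invertible self-adjoint elements of $B$ are norm dense in the set of self-adjoint elements of $B$. Here $\mathrm{K}_0(A)$ is the Grothendieck group of the commutative monoid of Murray–von Neumann equivalence classes of projections in the matrix algebras $M_n(A)$ (where $p\in M_m(A)$ and $q\in M_n(A)$ are equivalent if $p=v^*v$ and $q=vv^*$ for some $v\in M_{n\times m}(A)$, and addition is induced by the direct sum $\mathrm{diag}(p,q)$), and $\mathrm{K}_0(\varphi)\colon \mathrm{K}_0(A)\to \mathrm{K}_0(B)$ is the group homomorphism with $\mathrm{K}_0(\varphi)([p]_0)=[\varphi(p)]_0$, where $\varphi$ is applied entrywise to $p$. Then the quotient group $$\frac{\mathrm{K}_0(B)}{\mathrm{K}_0(\varphi)(\mathrm{K}_0(A))}$$ is torsion free, i.e. $nx=0$ with $n\geq 1$ an integer implies $x=0$. If, moreover, $A$ has real rank zero, then $\mathrm{K}_0(\varphi)$ is injective. -/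

import Mathlib

open scoped Matrix

noncomputable section

namespace CStarK

universe u v

/-- A unital C*-algebra has real rank zero if the invertible self-adjoint elements are norm dense
in the set of all self-adjoint elements. -/
def RealRankZero (A : Type u) [CStarAlgebra A] : Prop :=
  ∀ a : A, IsSelfAdjoint a → ∀ ε : ℝ, 0 < ε →
    ∃ b : A, IsSelfAdjoint b ∧ IsUnit b ∧ ‖a - b‖ < ε

section MurrayVonNeumann

variable {A : Type u} [CStarAlgebra A]

/-- Murray-von Neumann equivalence of square matrices over `A`, possibly of different sizes:
`p = v* v` and `q = v v*` for some rectangular matrix `v` over `A`. -/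
def MvN {m n : Type} [Fintype m] [Fintype n] (p : Matrix m m A) (q : Matrix n n A) : Prop :=
  ∃ v : Matrix n m A, p = vᴴ * v ∧ q = v * vᴴ

theorem MvN.refl {m : Type} [Fintype m] {p : Matrix m m A} (hp : IsStarProjection p) :
    MvN p p := by
  have h1 : pᴴ = p := hp.isSelfAdjoint
  have h2 : p * p = p := hp.isIdempotentElem
  exact ⟨p, by rw [h1, h2], by rw [h1, h2]⟩

theorem MvN.symm {m n : Type} [Fintype m] [Fintype n] {p : Matrix m m A} {q : Matrix n n A}
    (h : MvN p q) : MvN q p := by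
  obtain ⟨v, h1, h2⟩ := h
  exact ⟨vᴴ, by rw [Matrix.conjTranspose_conjTranspose, h2],
    by rw [Matrix.conjTranspose_conjTranspose, h1]⟩

theorem MvN.trans {l m n : Type} [Fintype l] [Fintype m] [Fintype n]
    {p : Matrix l l A} {q : Matrix m m A} {r : Matrix n n A}
    (hp : IsStarProjection p) (hr : IsStarProjection r) (h : MvN p q) (h' : MvN q r) :
    MvN p r := by
  obtain ⟨v, h1, h2⟩ := h
  obtain ⟨w, h3, h4⟩ := h'
  have hp2 : p * p = p := hp.isIdempotentElem
  have hr2 : r * r = r := hr.isIdempotentElem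
  refine ⟨w * v, ?_, ?_⟩
  · calc p = (vᴴ * v) * (vᴴ * v) := by rw [← h1, hp2]
      _ = vᴴ * (v * vᴴ) * v := by simp only [Matrix.mul_assoc]
      _ = vᴴ * (wᴴ * w) * v := by rw [← h2, h3]
      _ = (w * v)ᴴ * (w * v) := by simp only [Matrix.conjTranspose_mul, Matrix.mul_assoc]
  · calc r = (w * wᴴ) * (w * wᴴ) := by rw [← h4, hr2]
      _ = w * (wᴴ * w) * wᴴ := by simp only [Matrix.mul_assoc]
      _ = w * (v * vᴴ) * wᴴ := by rw [← h3, h2]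
      _ = (w * v) * (w * v)ᴴ := by simp only [Matrix.conjTranspose_mul, Matrix.mul_assoc]

theorem MvN.of_equiv {m n : Type} [Fintype m] [Fintype n] (e : m ≃ n) {p : Matrix m m A}
    (hp : IsStarProjection p) : MvN p (p.submatrix e.symm e.symm) := by
  have h1 : pᴴ = p := hp.isSelfAdjoint
  have h2 : p * p = p := hp.isIdempotentElem
  refine ⟨p.submatrix e.symm id, ?_, ?_⟩
  · rw [Matrix.conjTranspose_submatrix, h1, Matrix.submatrix_mul_equiv, h2, Matrix.submatrix_id_id]
  · rw [Matrix.conjTranspose_submatrix, h1,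
      ← Matrix.submatrix_mul _ _ _ _ _ Function.bijective_id, h2]

theorem MvN.fromBlocks {m n m' n' : Type} [Fintype m] [Fintype n] [Fintype m'] [Fintype n']
    {p : Matrix m m A} {q : Matrix n n A} {p' : Matrix m' m' A} {q' : Matrix n' n' A}
    (h : MvN p p') (h' : MvN q q') :
    MvN (Matrix.fromBlocks p 0 0 q) (Matrix.fromBlocks p' 0 0 q') := by
  obtain ⟨v, h1, h2⟩ := h
  obtain ⟨w, h3, h4⟩ := h'
  refine ⟨Matrix.fromBlocks v 0 0 w, ?_, ?_⟩
  · simp [Matrix.fromBlocks_conjTranspose, Matrix.fromBlocks_multiply, h1, h3]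
  · simp [Matrix.fromBlocks_conjTranspose, Matrix.fromBlocks_multiply, h2, h4]

theorem isStarProjection_fromBlocks {m n : Type} [Fintype m] [Fintype n]
    {p : Matrix m m A} {q : Matrix n n A} (hp : IsStarProjection p) (hq : IsStarProjection q) :
    IsStarProjection (Matrix.fromBlocks p 0 0 q) := by
  have h1 : pᴴ = p := hp.isSelfAdjoint
  have h2 : p * p = p := hp.isIdempotentElem
  have h3 : qᴴ = q := hq.isSelfAdjoint
  have h4 : q * q = q := hq.isIdempotentElem
  constructor
  · simp [IsIdempotentElem, Matrix.fromBlocks_multiply, h2, h4]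
  · simp [IsSelfAdjoint, Matrix.star_eq_conjTranspose, Matrix.fromBlocks_conjTranspose, h1, h3]

theorem isStarProjection_submatrix {m n : Type} [Fintype m] [Fintype n] (e : n ≃ m)
    {p : Matrix m m A} (hp : IsStarProjection p) : IsStarProjection (p.submatrix e e) := by
  have h1 : pᴴ = p := hp.isSelfAdjoint
  have h2 : p * p = p := hp.isIdempotentElem
  constructor
  · rw [IsIdempotentElem, Matrix.submatrix_mul_equiv, h2]
  · rw [IsSelfAdjoint, Matrix.star_eq_conjTranspose, Matrix.conjTranspose_submatrix, h1]

theorem MvN.map {B : Type v} [CStarAlgebra B] (φ : A →⋆ₐ[ℂ] B) {m n : Type} [Fintype m]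
    [Fintype n] {p : Matrix m m A} {q : Matrix n n A} (h : MvN p q) :
    MvN (p.map φ) (q.map φ) := by
  obtain ⟨v, h1, h2⟩ := h
  refine ⟨v.map φ, ?_, ?_⟩
  · rw [← Matrix.conjTranspose_map _ (fun x => map_star φ x), ← Matrix.map_mul, h1]
  · rw [← Matrix.conjTranspose_map _ (fun x => map_star φ x), ← Matrix.map_mul, h2]

end MurrayVonNeumann

/-- The projections in matrix algebras over `A`: a size `n` together with a projection in
`M_n(A)`. The size `0` is included; its only projection is equivalent to every zero projection. -/
structure Proj (A : Type u) [CStarAlgebra A] where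
  /-- the size of the matrix -/
  size : ℕ
  /-- the matrix -/
  mat : Matrix (Fin size) (Fin size) A
  isProj : IsStarProjection mat

namespace Proj

variable {A : Type u} [CStarAlgebra A]

instance instSetoid (A : Type u) [CStarAlgebra A] : Setoid (Proj A) where
  r p q := MvN p.mat q.mat
  iseqv :=
    { refl := fun p => MvN.refl p.isProj
      symm := fun h => h.symm
      trans := fun {p _ r} h h' => h.trans p.isProj r.isProj h' }

/-- The direct sum `diag(p, q)` of two matrix projections. -/
def dsum (p q : Proj A) : Proj A where
  size := p.size + q.size
  mat := (Matrix.fromBlocks p.mat 0 0 q.mat).submatrix finSumFinEquiv.symm finSumFinEquiv.symm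
  isProj := isStarProjection_submatrix _ (isStarProjection_fromBlocks p.isProj q.isProj)

theorem dsum_mvN (p q : Proj A) : MvN (Matrix.fromBlocks p.mat 0 0 q.mat) (dsum p q).mat :=
  MvN.of_equiv finSumFinEquiv (isStarProjection_fromBlocks p.isProj q.isProj)

theorem dsum_congr {p p' q q' : Proj A} (h : p ≈ p') (h' : q ≈ q') : dsum p q ≈ dsum p' q' :=
  ((dsum_mvN p q).symm.trans (dsum p q).isProj (isStarProjection_fromBlocks p'.isProj q'.isProj)
    (MvN.fromBlocks h h')).trans (dsum p q).isProj (dsum p' q').isProj (dsum_mvN p' q')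

/-- The zero projection (of size `0`). -/
def zero (A : Type u) [CStarAlgebra A] : Proj A where
  size := 0
  mat := 0
  isProj := IsStarProjection.zero _

/-- The entrywise image of a matrix projection under a unital *-homomorphism. -/
def map {B : Type v} [CStarAlgebra B] (φ : A →⋆ₐ[ℂ] B) (p : Proj A) : Proj B where
  size := p.size
  mat := p.mat.map φ
  isProj := by
    have h1 : p.matᴴ = p.mat := p.isProj.isSelfAdjoint
    have h2 : p.mat * p.mat = p.mat := p.isProj.isIdempotentElem
    constructor
    · rw [IsIdempotentElem, ← Matrix.map_mul, h2]
    · rw [IsSelfAdjoint, Matrix.star_eq_conjTranspose,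
        ← Matrix.conjTranspose_map _ (fun x => map_star φ x), h1]

theorem map_congr {B : Type v} [CStarAlgebra B] (φ : A →⋆ₐ[ℂ] B) {p q : Proj A} (h : p ≈ q) :
    map φ p ≈ map φ q :=
  MvN.map φ h

theorem map_dsum {B : Type v} [CStarAlgebra B] (φ : A →⋆ₐ[ℂ] B) (p q : Proj A) :
    map φ (dsum p q) = dsum (map φ p) (map φ q) := by
  have : ((Matrix.fromBlocks p.mat 0 0 q.mat).submatrix finSumFinEquiv.symm
      finSumFinEquiv.symm).map φ = (Matrix.fromBlocks (p.mat.map φ) 0 0 (q.mat.map φ)).submatrix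
      finSumFinEquiv.symm finSumFinEquiv.symm := by
    rw [← Matrix.submatrix_map, Matrix.fromBlocks_map, Matrix.map_zero _ (map_zero φ),
      Matrix.map_zero _ (map_zero φ)]
  have key : ∀ (n : ℕ) (x y : Matrix (Fin n) (Fin n) B) (hx : IsStarProjection x)
      (hy : IsStarProjection y), x = y → (⟨n, x, hx⟩ : Proj B) = ⟨n, y, hy⟩ := by
    rintro n x _ hx hy rfl
    rfl
  exact key _ _ _ _ _ this

theorem dsum_comm (p q : Proj A) : dsum p q ≈ dsum q p := by
  have h := MvN.of_equiv (Equiv.sumComm (Fin p.size) (Fin q.size))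
    (isStarProjection_fromBlocks p.isProj q.isProj)
  have e : (Matrix.fromBlocks p.mat 0 0 q.mat).submatrix
      (Equiv.sumComm (Fin p.size) (Fin q.size)).symm
      (Equiv.sumComm (Fin p.size) (Fin q.size)).symm = Matrix.fromBlocks q.mat 0 0 p.mat := by
    ext (i | i) (j | j) <;> rfl
  rw [e] at h
  exact ((dsum_mvN p q).symm.trans (dsum p q).isProj
    (isStarProjection_fromBlocks q.isProj p.isProj) h).trans (dsum p q).isProj
      (dsum q p).isProj (dsum_mvN q p)

theorem dsum_assoc (p q r : Proj A) : dsum (dsum p q) r ≈ dsum p (dsum q r) := by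
  have hL := isStarProjection_fromBlocks (isStarProjection_fromBlocks p.isProj q.isProj) r.isProj
  have hR := isStarProjection_fromBlocks p.isProj (isStarProjection_fromBlocks q.isProj r.isProj)
  have h := MvN.of_equiv (Equiv.sumAssoc (Fin p.size) (Fin q.size) (Fin r.size)) hL
  have e : (Matrix.fromBlocks (Matrix.fromBlocks p.mat 0 0 q.mat) 0 0 r.mat).submatrix
      (Equiv.sumAssoc (Fin p.size) (Fin q.size) (Fin r.size)).symm
      (Equiv.sumAssoc (Fin p.size) (Fin q.size) (Fin r.size)).symm =
      Matrix.fromBlocks p.mat 0 0 (Matrix.fromBlocks q.mat 0 0 r.mat) := by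
    ext (i | i | i) (j | j | j) <;> rfl
  rw [e] at h
  have a1 := (dsum_mvN (dsum p q) r).symm.trans (dsum (dsum p q) r).isProj hL
    (MvN.fromBlocks (dsum_mvN p q).symm (MvN.refl r.isProj))
  have a2 := (MvN.fromBlocks (MvN.refl p.isProj) (dsum_mvN q r)).trans hR
    (dsum p (dsum q r)).isProj (dsum_mvN p (dsum q r))
  exact (a1.trans (dsum (dsum p q) r).isProj hR h).trans (dsum (dsum p q) r).isProj
    (dsum p (dsum q r)).isProj a2

theorem dsum_zero (p : Proj A) : dsum p (zero A) ≈ p := by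
  have : IsEmpty (Fin (zero A).size) := inferInstanceAs (IsEmpty (Fin 0))
  have hp := isStarProjection_fromBlocks p.isProj (zero A).isProj
  have h := MvN.of_equiv (Equiv.sumEmpty (Fin p.size) (Fin (zero A).size)) hp
  have e : (Matrix.fromBlocks p.mat 0 0 (zero A).mat).submatrix
      (Equiv.sumEmpty (Fin p.size) (Fin (zero A).size)).symm
      (Equiv.sumEmpty (Fin p.size) (Fin (zero A).size)).symm = p.mat := by
    ext i j
    rfl
  rw [e] at h
  exact (dsum_mvN p (zero A)).symm.trans (dsum p (zero A)).isProj p.isProj h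

end Proj

/-- The semigroup of Murray-von Neumann classes of projections in matrices over `A`. -/
def D (A : Type u) [CStarAlgebra A] : Type u := Quotient (Proj.instSetoid A)

namespace D

/-- The class of a matrix projection. -/
def mk {A : Type u} [CStarAlgebra A] (p : Proj A) : D A := Quotient.mk _ p

/-- The zero element is the class of the zero projection. -/
instance instZero (A : Type u) [CStarAlgebra A] : Zero (D A) := ⟨mk (Proj.zero A)⟩

/-- Addition of classes is induced by the direct sum of projections. -/
instance instAdd (A : Type u) [CStarAlgebra A] : Add (D A) :=
  ⟨Quotient.map₂ Proj.dsum fun _ _ h _ _ h' => Proj.dsum_congr h h'⟩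

instance instAddCommMonoid (A : Type u) [CStarAlgebra A] : AddCommMonoid (D A) where
  add_assoc := by
    rintro ⟨p⟩ ⟨q⟩ ⟨r⟩
    exact Quotient.sound (Proj.dsum_assoc p q r)
  add_comm := by
    rintro ⟨p⟩ ⟨q⟩
    exact Quotient.sound (Proj.dsum_comm p q)
  add_zero := by
    rintro ⟨p⟩
    exact Quotient.sound (Proj.dsum_zero p)
  zero_add := by
    rintro ⟨p⟩
    exact Quotient.sound (Setoid.trans (Proj.dsum_comm _ p) (Proj.dsum_zero p))
  nsmul := nsmulRec

/-- The homomorphism `[p] ↦ [φ(p)]` induced by a unital *-homomorphism `φ`. -/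
def map {A : Type u} {B : Type v} [CStarAlgebra A] [CStarAlgebra B] (φ : A →⋆ₐ[ℂ] B) :
    D A →+ D B where
  toFun := Quotient.map (Proj.map φ) fun _ _ h => Proj.map_congr φ h
  map_zero' := by
    refine Quotient.sound ⟨0, ?_, ?_⟩ <;> exact Subsingleton.elim (α := Matrix (Fin 0) (Fin 0) B) _ _
  map_add' := by
    rintro ⟨p⟩ ⟨q⟩
    exact congrArg mk (Proj.map_dsum φ p q)

end D

/-- The group `K₀(A)` of a unital C*-algebra `A`: the Grothendieck group of `D A`. -/
abbrev K0 (A : Type u) [CStarAlgebra A] : Type u := Algebra.GrothendieckAddGroup (D A)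

namespace K0

/-- The class `[p]₀` of a matrix projection. -/
def cls {A : Type u} [CStarAlgebra A] (p : Proj A) : K0 A :=
  Algebra.GrothendieckAddGroup.of (D.mk p)

/-- The homomorphism `K₀(φ)` induced by a unital *-homomorphism `φ`. -/
def map {A : Type u} {B : Type v} [CStarAlgebra A] [CStarAlgebra B] (φ : A →⋆ₐ[ℂ] B) :
    K0 A →+ K0 B :=
  Algebra.GrothendieckAddGroup.lift (Algebra.GrothendieckAddGroup.of.comp (D.map φ))

/-- `K₀(φ)` sends `[p]₀` to `[φ(p)]₀`. -/
theorem map_cls {A : Type u} {B : Type v} [CStarAlgebra A] [CStarAlgebra B] (φ : A →⋆ₐ[ℂ] B)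
    (p : Proj A) : map φ (cls p) = cls (p.map φ) :=
  DFunLike.congr_fun (Algebra.GrothendieckAddGroup.lift.symm_apply_apply
    (Algebra.GrothendieckAddGroup.of.comp (D.map φ))) (D.mk p)

end K0

end CStarK

end

noncomputable section

namespace CStarK

/-! Over a commutative algebra the trace is invariant under Murray-von Neumann equivalence, so it
gives a natural homomorphism `K0.tr` from K₀(A) to A. Its range is the set of integer-valued
elements: a character sends the trace of a projection to a rank, and an integer-valued element is a
finite integer combination of indicator projections (`K0.exists_tr_eq`). In real rank zero the trace
is also injective (`RealRankZero.tr_injective`): the character space has a basis of clopen sets, so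
equivalences found at single characters spread to clopen neighbourhoods and glue.

If n x = K₀(φ)(y), then φ maps tr(y)/n to tr(x), which is integer-valued. An injective
*-homomorphism preserves spectra, so tr(y)/n is itself integer-valued, hence equal to tr(z) for some
z, and injectivity of the trace on K₀(B) gives x = K₀(φ)(z). If A also has real rank zero, then φ ∘
tr = tr ∘ K₀(φ) is injective, hence so is K₀(φ). -/

open WeakDual

/-! ### Equivalence of projections by polar decomposition. -/

section PolarDecomposition

/-- An invertible sum of squares `b` has a self-adjoint inverse square root in its
bicommutant. -/
theorem exists_isSelfAdjoint_inv_sqrt {M ι : Type*} [CStarAlgebra M] [Fintype ι] {b y : M}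
    {x : ι → M} (hb : b = (∑ i, star (x i) * x i) + star y * y) (hu : IsUnit b) :
    ∃ s : M, IsSelfAdjoint s ∧ s * s * b = 1 ∧ ∀ c, Commute c b → Commute c s := by
  let := CStarAlgebra.spectralOrder M
  have := CStarAlgebra.spectralOrderedRing M
  have h0 : 0 ≤ b := hb ▸ add_nonneg
    (Finset.sum_nonneg fun i _ => star_mul_self_nonneg (x i)) (star_mul_self_nonneg y)
  have hr : CFC.sqrt b * CFC.sqrt b = b := CFC.sqrt_mul_sqrt_self b
  obtain ⟨r, hr'⟩ := (CFC.isUnit_sqrt_iff b).2 hu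
  have hrs : IsSelfAdjoint (r : M) := by
    rw [hr']; exact (CFC.sqrt_nonneg b).isSelfAdjoint
  rw [← hr'] at hr
  refine ⟨(r⁻¹ : Mˣ), ?_, ?_, fun c hc => ?_⟩
  · have : star r = r := Units.ext hrs
    change star ((r⁻¹ : Mˣ) : M) = _
    rw [← Units.coe_star_inv, this]
  · rw [← hr, mul_assoc, ← mul_assoc _ (r : M), Units.inv_mul, one_mul, Units.inv_mul]
  · refine Commute.units_inv_right ?_
    rw [hr', CFC.sqrt_eq_cfc]
    exact (Commute.cfc_nnreal hc.symm _).symm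

/-- Functional calculus needs square matrices, so the `k`-th row of `x` is placed in row `i₀` of a
square matrix `z k` that is otherwise zero; then `xᴴ * x` is the sum of the `(z k)ᴴ * z k`. -/
theorem exists_isSelfAdjoint_inv_sqrt_matrix {A : Type*} [CStarAlgebra A] {m n : Type*}
    [Fintype m] [Fintype n] [DecidableEq n] {b y : Matrix n n A} {x : Matrix m n A}
    (hb : b = xᴴ * x + yᴴ * y) (hu : IsUnit b) :
    ∃ s : Matrix n n A, sᴴ = s ∧ s * s * b = 1 ∧ ∀ c, Commute c b → Commute c s := by
  rcases isEmpty_or_nonempty n with hn | ⟨⟨i₀⟩⟩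
  · exact ⟨1, Subsingleton.elim _ _, Subsingleton.elim _ _, fun c _ => Commute.one_right c⟩
  let := CStarAlgebra.spectralOrder A
  have := CStarAlgebra.spectralOrderedRing A
  let z (k : m) : Matrix n n A := Matrix.of fun i j => if i = i₀ then x k j else 0
  have hz : xᴴ * x = ∑ k, (z k)ᴴ * z k := by
    ext i j
    simp only [Matrix.mul_apply, Matrix.sum_apply, Matrix.conjTranspose_apply, z, Matrix.of_apply]
    exact Finset.sum_congr rfl fun k _ => by simp
  rw [hz] at hb
  exact exists_isSelfAdjoint_inv_sqrt (M := CStarMatrix n n A) (b := b)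
    (x := z) (y := y) hb hu

/-- A rectangular matrix `w` with `q w = w = w p` that is invertible from the range of `p` to the
range of `q` implements, after polar decomposition, an equivalence of `p` and `q`. -/
theorem MvN.of_isUnit {A : Type*} [CStarAlgebra A] {m n : Type} [Fintype m] [DecidableEq m]
    [Fintype n] [DecidableEq n] {p : Matrix m m A} {q : Matrix n n A}
    (hp : IsStarProjection p) (hq : IsStarProjection q) {w : Matrix n m A}
    (hwp : w * p = w) (hqw : q * w = w) (hu : IsUnit (wᴴ * w + (1 - p)))
    (hu' : IsUnit (w * wᴴ + (1 - q))) : MvN p q := by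
  have hp1 : pᴴ = p := hp.isSelfAdjoint
  have hp2 : p * p = p := hp.isIdempotentElem
  have hq1 : qᴴ = q := hq.isSelfAdjoint
  have hq2 : q * q = q := hq.isIdempotentElem
  have hpw : p * wᴴ = wᴴ := by rw [← hp1, ← Matrix.conjTranspose_mul, hwp]
  have hwq : wᴴ * q = wᴴ := by rw [← hq1, ← Matrix.conjTranspose_mul, hqw]
  have hb : wᴴ * w + (1 - p) = wᴴ * w + (1 - p)ᴴ * (1 - p) := by
    rw [Matrix.conjTranspose_sub, Matrix.conjTranspose_one, hp1, mul_sub, sub_mul, sub_mul, hp2]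
    simp
  obtain ⟨s, hs, hsb, hc⟩ := exists_isSelfAdjoint_inv_sqrt_matrix hb hu
  set b := wᴴ * w + (1 - p) with hbdef
  have hbp : b * p = wᴴ * w := by
    rw [hbdef, add_mul, sub_mul, hp2, Matrix.mul_assoc, hwp]; simp
  have hpb : p * b = wᴴ * w := by
    rw [hbdef, mul_add, mul_sub, hp2, ← Matrix.mul_assoc, hpw]; simp
  have hps : p * s = s * p := hc p (hpb.trans hbp.symm)
  have hbs : b * s = s * b := hc b (Commute.refl b)
  -- The inverse square root `s` of `b` commutes with `p`, so `w * s` is the partial isometry in the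
  -- polar decomposition of `w`.
  have hwss : w * (s * s) * (wᴴ * w) = w := by
    rw [← hbp, Matrix.mul_assoc, ← Matrix.mul_assoc (s * s), hsb, Matrix.one_mul, hwp]
  refine ⟨w * s, ?_, ?_⟩
  · rw [Matrix.conjTranspose_mul, hs]
    calc p = s * s * b * p := by rw [hsb, one_mul]
      _ = s * (s * b) * p := by rw [mul_assoc s s b]
      _ = s * (b * p) * s := by rw [← hbs]; simp only [mul_assoc]; rw [hps]
      _ = s * wᴴ * (w * s) := by rw [hbp]; simp only [Matrix.mul_assoc]
  · rw [Matrix.conjTranspose_mul, hs]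
    set r := w * s * (s * wᴴ) with hr
    have hrq : r * q = r := by simp only [hr, Matrix.mul_assoc, hwq]
    have hrw : r * w = w := by
      calc r * w = w * (s * s) * (wᴴ * w) := by simp only [hr, Matrix.mul_assoc]
        _ = w := hwss
    -- Left multiplication by `q` and by `r` agrees on `w`, and both annihilate `1 - q`;
    -- invertibility of the second matrix then forces `r = q`.
    have h0 : (q - r) * (w * wᴴ + (1 - q)) = 0 := by
      rw [mul_add, ← Matrix.mul_assoc, Matrix.sub_mul, hqw, hrw, mul_sub, sub_mul, sub_mul, hq2, hrq]
      simp
    exact sub_eq_zero.1 ((hu'.mul_left_eq_zero).1 h0)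

end PolarDecomposition

/-! ### Projections in complex matrix algebras. -/

section Complex

/-- A complex projection is equivalent to an identity matrix. -/
theorem exists_mvN_one {n : Type} [Fintype n] [DecidableEq n] {p : Matrix n n ℂ}
    (hp : IsStarProjection p) : ∃ r : ℕ, MvN p (1 : Matrix (Fin r) (Fin r) ℂ) := by
  have hp1 : p.IsHermitian := hp.isSelfAdjoint
  have hp2 : p * p = p := hp.isIdempotentElem
  let U : Matrix n n ℂ := (hp1.eigenvectorUnitary : Matrix n n ℂ)
  have hUU : Uᴴ * U = 1 := Unitary.coe_star_mul_self hp1.eigenvectorUnitary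
  have hspec : p = U * Matrix.diagonal (fun i => (hp1.eigenvalues i : ℂ)) * Uᴴ := by
    conv_lhs => rw [hp1.spectral_theorem, Unitary.conjStarAlgAut_apply]
    rfl
  have hev : ∀ i, (hp1.eigenvalues i : ℂ) = 0 ∨ (hp1.eigenvalues i : ℂ) = 1 := by
    intro i
    have h : (Matrix.diagonal (fun i => (hp1.eigenvalues i : ℂ))) *
        (Matrix.diagonal (fun i => (hp1.eigenvalues i : ℂ))) =
        Matrix.diagonal (fun i => (hp1.eigenvalues i : ℂ)) := by
      have hd : Matrix.diagonal (fun i => (hp1.eigenvalues i : ℂ)) = Uᴴ * p * U := by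
        conv_rhs => rw [hspec]
        simp only [Matrix.mul_assoc, hUU]
        rw [← Matrix.mul_assoc Uᴴ, hUU]; simp
      have hUU' : U * Uᴴ = 1 := mul_eq_one_comm.1 hUU
      rw [hd]
      simp only [Matrix.mul_assoc]
      rw [← Matrix.mul_assoc U Uᴴ, hUU', Matrix.one_mul, ← Matrix.mul_assoc p p, hp2]
    rw [Matrix.diagonal_mul_diagonal] at h
    have := congrFun (congrFun h i) i
    simp only [Matrix.diagonal_apply_eq] at this
    exact IsIdempotentElem.iff_eq_zero_or_one.1 this
  let S := {i // (hp1.eigenvalues i : ℂ) = 1}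
  classical
  let e : S ≃ Fin (Fintype.card S) := Fintype.equivFin S
  -- The columns of `U` with eigenvalue 1 form an orthonormal basis of the range of `p`.
  refine ⟨Fintype.card S, (U.submatrix id (fun k => (e.symm k : n)))ᴴ, ?_, ?_⟩
  · ext i j
    rw [Matrix.conjTranspose_conjTranspose]
    conv_lhs => rw [hspec]
    rw [Matrix.mul_apply, Matrix.mul_apply]
    simp only [Matrix.mul_diagonal, Matrix.submatrix_apply,
      Matrix.conjTranspose_apply, id]
    rw [Equiv.sum_comp e.symm (fun k : S => U i k * star (U j k))]
    rw [← Finset.sum_subtype (Finset.univ.filter fun i => (hp1.eigenvalues i : ℂ) = 1)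
      (by simp) (fun k => U i k * star (U j k)), Finset.sum_filter]
    refine Finset.sum_congr rfl fun k _ => ?_
    rcases hev k with h | h <;> simp [h]
  · ext i j
    have := congrFun (congrFun hUU (e.symm i)) (e.symm j)
    simp only [Matrix.mul_apply, Matrix.conjTranspose_apply, Matrix.one_apply] at this
    simp only [Matrix.mul_apply, Matrix.conjTranspose_apply, Matrix.one_apply,
      Matrix.submatrix_apply, id, star_star]
    rw [this]
    simp [Subtype.ext_iff.symm]

end Complex

/-! ### The trace on K₀. -/

section Trace

variable {A : Type*} [CommCStarAlgebra A]

theorem MvN.trace_eq {m n : Type} [Fintype m] [Fintype n] {p : Matrix m m A} {q : Matrix n n A}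
    (h : MvN p q) : p.trace = q.trace := by
  obtain ⟨v, rfl, rfl⟩ := h
  exact Matrix.trace_mul_comm _ _

/-- Complex projections of the same trace are equivalent. -/
theorem MvN.of_trace_eq {m n : Type} [Fintype m] [Fintype n] {p : Matrix m m ℂ}
    {q : Matrix n n ℂ} (hp : IsStarProjection p) (hq : IsStarProjection q)
    (h : p.trace = q.trace) : MvN p q := by
  classical
  obtain ⟨r, hr⟩ := exists_mvN_one hp
  obtain ⟨s, hs⟩ := exists_mvN_one hq
  have : r = s := by
    have := hr.trace_eq.symm.trans (h.trans hs.trace_eq)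
    simpa using this
  subst this
  exact hr.trans hp hq hs.symm

/-- The trace of matrix projections as a map on the semigroup of equivalence classes. -/
def D.tr (A : Type*) [CommCStarAlgebra A] : D A →+ A where
  toFun := Quotient.lift (fun p : Proj A => p.mat.trace) fun _ _ h => MvN.trace_eq h
  map_zero' := Matrix.trace_zero (Fin 0) A
  map_add' := by
    rintro ⟨p⟩ ⟨q⟩
    exact (Proj.dsum_mvN p q).trace_eq.symm.trans (by simp [Matrix.trace])

/-- The trace on `K₀` of a commutative C*-algebra. -/
def K0.tr (A : Type*) [CommCStarAlgebra A] : K0 A →+ A :=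
  Algebra.GrothendieckAddGroup.lift (D.tr A)

theorem K0.tr_cls (p : Proj A) : K0.tr A (K0.cls p) = p.mat.trace :=
  DFunLike.congr_fun (Algebra.GrothendieckAddGroup.lift.symm_apply_apply (D.tr A)) (D.mk p)

theorem K0.exists_eq_sub {A : Type*} [CStarAlgebra A] (x : K0 A) :
    ∃ p q : Proj A, x = K0.cls p - K0.cls q := by
  obtain ⟨⟨a, ⟨b, hb⟩⟩, h⟩ := (AddLocalization.addMonoidOf (⊤ : AddSubmonoid (D A))).surj x
  obtain ⟨p, rfl⟩ := Quotient.exists_rep a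
  obtain ⟨q, rfl⟩ := Quotient.exists_rep b
  exact ⟨p, q, eq_sub_iff_add_eq.2 h⟩

theorem K0.tr_map {B : Type*} [CommCStarAlgebra B] (φ : A →⋆ₐ[ℂ] B) (x : K0 A) :
    K0.tr B (K0.map φ x) = φ (K0.tr A x) := by
  obtain ⟨p, q, rfl⟩ := K0.exists_eq_sub x
  simp only [map_sub, K0.map_cls, K0.tr_cls]
  congr 1 <;> exact (AddMonoidHom.map_trace φ.toAddMonoidHom _).symm

end Trace

/-! ### Gelfand duality and clopen sets of characters. -/

section Characters

variable {A : Type*} [CommCStarAlgebra A]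

/-- A character of a commutative C*-algebra as a unital *-homomorphism. -/
def charHom (χ : characterSpace ℂ A) : A →⋆ₐ[ℂ] ℂ := (χ : A →⋆ₐ[ℂ] ℂ)

theorem continuous_charHom (a : A) : Continuous fun χ : characterSpace ℂ A => charHom χ a :=
  (gelfandStarTransform A a).continuous

theorem eq_of_forall_charHom {a b : A} (h : ∀ χ, charHom χ a = charHom χ b) : a = b :=
  (gelfandStarTransform A).injective (ContinuousMap.ext h)

theorem exists_forall_charHom_eq (f : C(characterSpace ℂ A, ℂ)) : ∃ a : A, ∀ χ, charHom χ a = f χ :=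
  ⟨(gelfandStarTransform A).symm f, fun χ =>
    DFunLike.congr_fun ((gelfandStarTransform A).apply_symm_apply f) χ⟩

theorem isUnit_of_forall_charHom_ne_zero {a : A} (h : ∀ χ, charHom χ a ≠ 0) : IsUnit a := by
  by_contra ha
  obtain ⟨χ, hχ⟩ := CharacterSpace.exists_apply_eq_zero ha
  exact h χ hχ

theorem exists_isStarProjection_of_isClopen {U : Set (characterSpace ℂ A)} (hU : IsClopen U) :
    ∃ e : A, IsStarProjection e ∧ (∀ χ ∈ U, charHom χ e = 1) ∧ ∀ χ ∉ U, charHom χ e = 0 := by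
  classical
  obtain ⟨e, he⟩ := exists_forall_charHom_eq (A := A)
    ⟨LocallyConstant.charFn ℂ hU, (LocallyConstant.charFn ℂ hU).continuous⟩
  simp only [ContinuousMap.coe_mk, LocallyConstant.coe_charFn, Set.indicator_apply,
    Pi.one_apply] at he
  refine ⟨e, ⟨?_, ?_⟩, fun χ h => by simp [he, h], fun χ h => by simp [he, h]⟩
  · exact eq_of_forall_charHom fun χ => by simp [he]
  · refine eq_of_forall_charHom fun χ => ?_
    rw [map_star, he]
    split_ifs <;> simp

/-- The character space of a commutative C*-algebra of real rank zero has a basis of clopen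
sets. -/
theorem RealRankZero.exists_isClopen (hA : RealRankZero A) {χ : characterSpace ℂ A}
    {V : Set (characterSpace ℂ A)} (hV : IsOpen V) (hχ : χ ∈ V) :
    ∃ U, IsClopen U ∧ χ ∈ U ∧ U ⊆ V := by
  obtain ⟨f, hf0, hf1, -⟩ := exists_continuous_zero_one_of_isClosed hV.isClosed_compl
    (isClosed_singleton (x := χ)) (by simpa using hχ)
  -- The function 2f - 1 is 1 at `χ` and -1 off `V`, so a real approximation with error less than 1
  -- keeps these signs.
  obtain ⟨a, ha⟩ := exists_forall_charHom_eq (A := A)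
    ⟨fun ψ => ((2 * f ψ - 1 : ℝ) : ℂ), by fun_prop⟩
  simp only [ContinuousMap.coe_mk] at ha
  have hsa : IsSelfAdjoint a := eq_of_forall_charHom fun ψ => by
    rw [map_star, ha]; exact Complex.conj_ofReal _
  obtain ⟨b, hb, hbu, hab⟩ := hA a hsa 1 one_pos
  have hclose (ψ : characterSpace ℂ A) : |(2 * f ψ - 1) - (charHom ψ b).re| < 1 := by
    calc |(2 * f ψ - 1) - (charHom ψ b).re| = |(charHom ψ (a - b)).re| := by
          rw [map_sub, ha, Complex.sub_re, Complex.ofReal_re]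
      _ ≤ ‖charHom ψ (a - b)‖ := Complex.abs_re_le_norm _
      _ ≤ ‖a - b‖ := NonUnitalStarAlgHom.norm_apply_le (charHom ψ) _
      _ < 1 := hab
  have hne (ψ : characterSpace ℂ A) : (charHom ψ b).re ≠ 0 := by
    intro h
    refine (hbu.map (charHom ψ)).ne_zero (Complex.ext h ?_)
    have : star (charHom ψ b) = charHom ψ b := by rw [← map_star, hb.star_eq]
    exact Complex.conj_eq_iff_im.1 this
  have hcont : Continuous fun ψ : characterSpace ℂ A => (charHom ψ b).re :=
    Complex.continuous_re.comp (continuous_charHom b)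
  refine ⟨{ψ | 0 < (charHom ψ b).re}, ⟨?_, isOpen_lt continuous_const hcont⟩, ?_, ?_⟩
  -- Since `b` is invertible its transform never vanishes, so the strict and the weak inequality cut
  -- out the same set.
  · have : {ψ : characterSpace ℂ A | 0 < (charHom ψ b).re} = {ψ | 0 ≤ (charHom ψ b).re} := by
      ext ψ
      exact (hne ψ).symm.le_iff_lt.symm
    rw [this]
    exact isClosed_le continuous_const hcont
  · have h := abs_lt.1 (hclose χ)
    have h1 : f χ = 1 := hf1 rfl
    rw [h1] at h
    rw [Set.mem_ofPred_eq]
    linarith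
  · intro ψ hψ
    by_contra hψV
    have h := abs_lt.1 (hclose ψ)
    have h0 : f ψ = 0 := hf0 hψV
    rw [h0] at h
    have : 0 < (charHom ψ b).re := hψ
    linarith

end Characters

/-! ### Injectivity of the trace in real rank zero. -/

section Cancellation

variable {m n : Type} [Fintype m] [DecidableEq m] [Fintype n] [DecidableEq n]

/-- The determinant whose invertibility says that `w` is invertible from the range of `p` to the
range of `q`. -/
def polarDet {R : Type*} [CommRing R] [StarRing R] (p : Matrix m m R) (q : Matrix n n R)
    (w : Matrix n m R) : R :=
  (wᴴ * w + (1 - p)).det * (w * wᴴ + (1 - q)).det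

theorem map_polarDet {A B : Type*} [CommCStarAlgebra A] [CommCStarAlgebra B] (φ : A →⋆ₐ[ℂ] B)
    (p : Matrix m m A) (q : Matrix n n A) (w : Matrix n m A) :
    φ (polarDet p q w) = polarDet (p.map φ) (q.map φ) (w.map φ) := by
  have h := Matrix.conjTranspose_map (A := w) φ (fun x => map_star φ x)
  have hd {k : Type} [Fintype k] [DecidableEq k] (M : Matrix k k A) : φ M.det = (M.map φ).det :=
    AlgHom.map_det φ.toAlgHom M
  have hadd {k : Type} (M N : Matrix k k A) : (M + N).map φ = M.map φ + N.map φ :=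
    Matrix.map_add φ (map_add φ) M N
  have hsub {k : Type} (M N : Matrix k k A) : (M - N).map φ = M.map φ - N.map φ :=
    Matrix.map_sub φ (map_sub φ) M N
  have hone {k : Type} [DecidableEq k] : (1 : Matrix k k A).map φ = 1 :=
    Matrix.map_one φ (map_zero φ) (map_one φ)
  have hmul {k l o : Type} [Fintype l] (M : Matrix k l A) (N : Matrix l o A) :
      (M * N).map φ = M.map φ * N.map φ := Matrix.map_mul (f := φ)
  simp only [polarDet, map_mul, hd, hadd, hsub, hone, hmul, h]

variable {A : Type*} [CommCStarAlgebra A]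

theorem MvN.of_forall_polarDet {p : Matrix m m A} {q : Matrix n n A}
    (hp : IsStarProjection p) (hq : IsStarProjection q) {w : Matrix n m A}
    (hwp : w * p = w) (hqw : q * w = w) (h : ∀ χ, charHom χ (polarDet p q w) ≠ 0) :
    MvN p q := by
  have hu := isUnit_of_forall_charHom_ne_zero h
  rw [polarDet, IsUnit.mul_iff, ← Matrix.isUnit_iff_isUnit_det, ← Matrix.isUnit_iff_isUnit_det]
    at hu
  exact MvN.of_isUnit hp hq hwp hqw hu.1 hu.2

/-- An equivalence at `χ` is a complex matrix; viewed as a constant matrix over `A` and compressed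
by `q` and `p`, it becomes at `χ` a partial isometry from the range of `p` onto that of `q`, so both
matrices in `polarDet` become the identity there. -/
theorem exists_polarDet_charHom_eq_one {p : Matrix m m A} {q : Matrix n n A}
    (hp : IsStarProjection p) (hq : IsStarProjection q) {χ : characterSpace ℂ A}
    (h : MvN (p.map (charHom χ)) (q.map (charHom χ))) :
    ∃ w : Matrix n m A, w * p = w ∧ q * w = w ∧ charHom χ (polarDet p q w) = 1 := by
  have hp2 : p * p = p := hp.isIdempotentElem
  have hq2 : q * q = q := hq.isIdempotentElem
  have hpχ : p.map (charHom χ) * p.map (charHom χ) = p.map (charHom χ) := by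
    rw [← Matrix.map_mul, hp2]
  have hqχ : q.map (charHom χ) * q.map (charHom χ) = q.map (charHom χ) := by
    rw [← Matrix.map_mul, hq2]
  obtain ⟨v, h1, h2⟩ := h
  refine ⟨q * v.map (algebraMap ℂ A) * p, by rw [Matrix.mul_assoc, hp2],
    by rw [← Matrix.mul_assoc, ← Matrix.mul_assoc, hq2], ?_⟩
  have hv : (v.map (algebraMap ℂ A)).map (charHom χ) = v := by
    ext i j
    exact AlgHomClass.commutes (charHom χ) (v i j)
  rw [map_polarDet, Matrix.map_mul, Matrix.map_mul, hv]
  generalize p.map (charHom χ) = P at *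
  generalize q.map (charHom χ) = Q at *
  have hu : Q * v * P = v * P := by
    rw [h2, Matrix.mul_assoc v, ← h1, Matrix.mul_assoc, hpχ]
  have hu' : Q * v * P = Q * v := by
    rw [h1, Matrix.mul_assoc, ← Matrix.mul_assoc v, ← h2, ← Matrix.mul_assoc, hqχ]
  have hP : Pᴴ = P := by rw [h1]; simp
  have hQ : Qᴴ = Q := by rw [h2]; simp
  have e1 : (Q * v * P)ᴴ * (Q * v * P) = P := by
    rw [hu, Matrix.conjTranspose_mul, hP, Matrix.mul_assoc, ← Matrix.mul_assoc vᴴ, ← h1, hpχ, hpχ]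
  have e2 : (Q * v * P) * (Q * v * P)ᴴ = Q := by
    rw [hu', Matrix.conjTranspose_mul, hQ, Matrix.mul_assoc, ← Matrix.mul_assoc v, ← h2, hqχ, hqχ]
  rw [polarDet, e1, e2]
  simp

/-- Over a commutative C*-algebra of real rank zero, projections of the same trace are
equivalent. -/
theorem RealRankZero.mvN_of_trace_eq (hA : RealRankZero A) {p : Matrix m m A}
    {q : Matrix n n A} (hp : IsStarProjection p) (hq : IsStarProjection q)
    (h : p.trace = q.trace) : MvN p q := by
  have hχ (χ : characterSpace ℂ A) : MvN (p.map (charHom χ)) (q.map (charHom χ)) := by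
    have hmap {k : Type} [Fintype k] {r : Matrix k k A} (hr : IsStarProjection r) :
        IsStarProjection (r.map (charHom χ)) := by
      have h1 : rᴴ = r := hr.isSelfAdjoint
      have h2 : r * r = r := hr.isIdempotentElem
      constructor
      · rw [IsIdempotentElem, ← Matrix.map_mul, h2]
      · rw [IsSelfAdjoint, Matrix.star_eq_conjTranspose,
          ← Matrix.conjTranspose_map _ (fun x => map_star (charHom χ) x), h1]
    refine MvN.of_trace_eq (hmap hp) (hmap hq) ?_
    have := congrArg (charHom χ) h
    exact (AddMonoidHom.map_trace (charHom χ : A →+ ℂ) p).symm.trans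
      (this.trans (AddMonoidHom.map_trace (charHom χ : A →+ ℂ) q))
  -- Compactness induction on the sets contained in a clopen set over which a single `w` works.
  -- Clopenness is what puts the indicator function used for gluing in `A`.
  let P (s : Set (characterSpace ℂ A)) : Prop := ∃ U, IsClopen U ∧ s ⊆ U ∧
    ∃ w : Matrix n m A, w * p = w ∧ q * w = w ∧ ∀ χ ∈ U, charHom χ (polarDet p q w) ≠ 0
  have key : P Set.univ := by
    refine isCompact_univ.induction_on (p := P) ?_ ?_ ?_ ?_
    · exact ⟨∅, isClopen_empty, subset_rfl, 0, by simp⟩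
    · rintro s t hst ⟨U, hU, htU, hw⟩
      exact ⟨U, hU, hst.trans htU, hw⟩
    · rintro s t ⟨U, hU, hsU, w, hwp, hqw, hw⟩ ⟨V, hV, htV, w', hwp', hqw', hw'⟩
      obtain ⟨e, -, he1, he0⟩ := exists_isStarProjection_of_isClopen hU
      -- The glued matrix is `w` on `U` and `w'` off `U`; the conditions involving `p` and `q` are
      -- linear, so they survive.
      refine ⟨U ∪ V, hU.union hV, Set.union_subset_union hsU htV, e • w + (1 - e) • w', ?_, ?_, ?_⟩
      · rw [Matrix.add_mul, Matrix.smul_mul, Matrix.smul_mul, hwp, hwp']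
      · rw [Matrix.mul_add, Matrix.mul_smul, Matrix.mul_smul, hqw, hqw']
      · intro χ hχ
        by_cases hχU : χ ∈ U
        · have : (e • w + (1 - e) • w').map (charHom χ) = w.map (charHom χ) := by
            ext i j; simp [he1 χ hχU]
          rw [map_polarDet, this, ← map_polarDet]
          exact hw χ hχU
        · have : (e • w + (1 - e) • w').map (charHom χ) = w'.map (charHom χ) := by
            ext i j; simp [he0 χ hχU]
          rw [map_polarDet, this, ← map_polarDet]
          exact hw' χ (hχ.resolve_left hχU)
    · intro χ _
      obtain ⟨w, hwp, hqw, hw⟩ := exists_polarDet_charHom_eq_one hp hq (hχ χ)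
      obtain ⟨U, hU, hχU, hUV⟩ := hA.exists_isClopen (χ := χ)
        (isOpen_ne_fun (continuous_charHom (polarDet p q w)) continuous_const) (by
          change _ ≠ (0 : ℂ); rw [hw]; exact one_ne_zero)
      exact ⟨U, mem_nhdsWithin_of_mem_nhds (hU.isOpen.mem_nhds hχU), U, hU, subset_rfl, w, hwp,
        hqw, fun ψ hψ => hUV hψ⟩
  obtain ⟨U, -, hU, w, hwp, hqw, hw⟩ := key
  exact MvN.of_forall_polarDet hp hq hwp hqw fun χ => hw χ (hU trivial)

theorem RealRankZero.tr_injective (hA : RealRankZero A) : Function.Injective (K0.tr A) := by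
  rw [injective_iff_map_eq_zero]
  intro x hx
  obtain ⟨p, q, rfl⟩ := K0.exists_eq_sub x
  rw [map_sub, K0.tr_cls, K0.tr_cls, sub_eq_zero] at hx
  rw [sub_eq_zero]
  exact congrArg Algebra.GrothendieckAddGroup.of (Quotient.sound (s := Proj.instSetoid A)
    (hA.mvN_of_trace_eq p.isProj q.isProj hx))

end Cancellation

/-! ### The range of the trace. -/

section Range

variable {A : Type*} [CommCStarAlgebra A]

theorem K0.exists_charHom_tr_eq (x : K0 A) (χ : characterSpace ℂ A) :
    ∃ k : ℤ, charHom χ (K0.tr A x) = k := by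
  have h (p : Proj A) : ∃ k : ℤ, charHom χ p.mat.trace = k := by
    obtain ⟨r, hr⟩ := exists_mvN_one (p.map (charHom χ)).isProj
    refine ⟨r, ?_⟩
    have := hr.trace_eq
    rw [Matrix.trace_one, Fintype.card_fin] at this
    exact (AddMonoidHom.map_trace (charHom χ : A →+ ℂ) p.mat).trans (by exact_mod_cast this)
  obtain ⟨p, q, rfl⟩ := K0.exists_eq_sub x
  obtain ⟨k, hk⟩ := h p
  obtain ⟨l, hl⟩ := h q
  exact ⟨k - l, by rw [map_sub, map_sub, tr_cls, tr_cls, hk, hl]; push_cast; rfl⟩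

theorem K0.exists_tr_eq_of_isStarProjection {e : A} (he : IsStarProjection e) :
    ∃ x, K0.tr A x = e := by
  have h1 : star e = e := he.isSelfAdjoint
  have h2 : e * e = e := he.isIdempotentElem
  let p : Proj A :=
    { size := 1
      mat := Matrix.of fun _ _ => e
      isProj := ⟨by ext i j; simp [Matrix.mul_apply, h2], by ext i j; simp [h1]⟩ }
  exact ⟨K0.cls p, (K0.tr_cls p).trans (by simp [p, Matrix.trace])⟩

/-- Every integer-valued element is the trace of a class in `K₀`. -/
theorem K0.exists_tr_eq {a : A} (ha : ∀ χ, ∃ k : ℤ, charHom χ a = k) : ∃ x, K0.tr A x = a := by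
  have hclopen (k : ℤ) : IsClopen {χ : characterSpace ℂ A | charHom χ a = k} := by
    refine ⟨isClosed_eq (continuous_charHom a) continuous_const, ?_⟩
    -- Distinct integers are at distance at least 1, so the level set is also given by an open
    -- condition.
    have : {χ : characterSpace ℂ A | charHom χ a = k} = {χ | ‖charHom χ a - k‖ < 1} := by
      ext χ
      obtain ⟨l, hl⟩ := ha χ
      simp only [Set.mem_ofPred_eq, hl]
      constructor
      · intro h; simp [h]
      · intro h
        rw [← Int.cast_sub, Complex.norm_intCast] at h
        have h' : |l - k| < 1 := by exact_mod_cast h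
        rw [Int.abs_lt_one_iff, sub_eq_zero] at h'
        rw [h']
    rw [this]
    exact isOpen_lt ((continuous_charHom a).sub continuous_const).norm continuous_const
  choose e he he1 he0 using fun k => exists_isStarProjection_of_isClopen (hclopen k)
  choose x hx using fun k => K0.exists_tr_eq_of_isStarProjection (he k)
  obtain ⟨N, hN⟩ := exists_nat_ge ‖a‖
  -- The element `a` is the sum of `k • e k` over its values, which are bounded by the norm of `a`.
  refine ⟨∑ k ∈ Finset.Icc (-N : ℤ) N, k • x k, ?_⟩
  simp only [map_sum, map_zsmul, hx]
  refine eq_of_forall_charHom fun χ => ?_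
  obtain ⟨l, hl⟩ := ha χ
  have hlN : l ∈ Finset.Icc (-N : ℤ) N := by
    have h : ‖charHom χ a‖ ≤ N := (NonUnitalStarAlgHom.norm_apply_le (charHom χ) a).trans hN
    rw [hl, Complex.norm_intCast] at h
    rw [Finset.mem_Icc, ← abs_le]
    exact_mod_cast h
  rw [map_sum, Finset.sum_eq_single_of_mem l hlN, map_zsmul, he1 l χ hl, hl]
  · simp
  · intro k _ hkl
    rw [map_zsmul, he0 k χ, smul_zero]
    intro h
    exact hkl (by exact_mod_cast h.symm.trans hl)

/-- An element which is integer-valued after an injective *-homomorphism is integer-valued. -/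
theorem exists_charHom_eq_intCast_of_injective {B : Type*} [CommCStarAlgebra B] {φ : A →⋆ₐ[ℂ] B}
    (hφ : Function.Injective φ) {a : A} (ha : ∀ ψ, ∃ k : ℤ, charHom ψ (φ a) = k)
    (χ : characterSpace ℂ A) : ∃ k : ℤ, charHom χ a = k := by
  have hsa : IsSelfAdjoint a := hφ (eq_of_forall_charHom fun ψ => by
    obtain ⟨k, hk⟩ := ha ψ
    rw [map_star, map_star, hk]
    simp)
  have hmem : charHom χ a ∈ spectrum ℂ a := CharacterSpace.mem_spectrum_iff_exists.2 ⟨χ, rfl⟩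
  have hre := hsa.mem_spectrum_eq_re hmem
  rw [hre] at hmem ⊢
  -- Characters take exactly the spectral values, and `φ` preserves the spectrum of the self-adjoint
  -- `a`; hence `χ(a)` is also the value of some `ψ` at `φ a`.
  have hmem' : (charHom χ a).re ∈ spectrum ℝ (φ a) := by
    rw [hsa.map_spectrum_real φ hφ]
    exact spectrum.of_algebraMap_mem ℂ hmem
  obtain ⟨ψ, hψ⟩ := CharacterSpace.mem_spectrum_iff_exists.1
    (spectrum.algebraMap_mem ℂ hmem')
  obtain ⟨k, hk⟩ := ha ψ
  exact ⟨k, hψ.symm.trans hk⟩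

end Range

end CStarK

end

/-! ### The quotient and injectivity of K₀(φ). -/

theorem theorem1 {A B : Type*} [CommCStarAlgebra A] [CommCStarAlgebra B] (φ : A →⋆ₐ[ℂ] B)
    (hφ : Function.Injective φ) (hB : CStarK.RealRankZero B) :
    IsAddTorsionFree (CStarK.K0 B ⧸ (CStarK.K0.map φ).range) ∧
      (CStarK.RealRankZero A → Function.Injective (CStarK.K0.map φ)) := by
  open CStarK in
  refine ⟨⟨fun n hn => ?_⟩, fun hA x y hxy => ?_⟩
  · change Function.Injective (nsmulAddMonoidHom (α := K0 B ⧸ (K0.map φ).range) n)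
    rw [injective_iff_map_eq_zero]
    intro x hx
    obtain ⟨x, rfl⟩ := QuotientAddGroup.mk_surjective x
    have hx' : n • x ∈ (K0.map φ).range := (QuotientAddGroup.eq_zero_iff _).1 hx
    obtain ⟨y, hy⟩ := hx'
    -- Division by `n` is impossible in K₀(A) but available for traces, which live in a complex
    -- vector space.
    have htr : φ ((n : ℂ)⁻¹ • K0.tr A y) = K0.tr B x := by
      have hn' : (n : ℂ) ≠ 0 := Nat.cast_ne_zero.2 hn
      rw [map_smul, ← K0.tr_map, hy, map_nsmul, ← Nat.cast_smul_eq_nsmul ℂ, smul_smul,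
        inv_mul_cancel₀ hn', one_smul]
    obtain ⟨z, hz⟩ := K0.exists_tr_eq (exists_charHom_eq_intCast_of_injective hφ
      (htr ▸ K0.exists_charHom_tr_eq x))
    rw [QuotientAddGroup.eq_zero_iff]
    exact ⟨z, hB.tr_injective (by rw [K0.tr_map, hz, htr])⟩
  · refine hA.tr_injective (hφ ?_)
    rw [← K0.tr_map, ← K0.tr_map, hxy]
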